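/- Let $\mathbb{K}$ be a non-archimedean local field with ring of integers $\mathcal{O}$ and uniformizer $\varpi$, and let $\mathfrak g$ be a finite-dimensional nilpotent $\mathbb{K}$-Lie algebra with a gradation $\mathfrak g=\bigoplus_{k\ge 1}V_k$, $[V_i,V_j]\subseteq V_{i+j}$. If $\mathbb{K}$ has positive characteristic, assume that the nilpotency class of $\mathfrak g$ is smaller than $\operatorname{char}\mathbb{K}$, so that the Baker–Campbell–Hausdorff product $\diamond$ is defined on $\mathfrak g$. Let $G$ be the corresponding graded $\mathbb{K}$-Lie group, that is, a topological group with a homeomorphism $\exp:\mathfrak g\to G$ such that $\exp(X)\exp(Y)=\exp(X\diamond Y)$. Let $Q=\sum_k k\dim V_k$ be its homogeneous dimension. For $\gamma\in\mathbb{K}^*$ let $D_\gamma$ be the dilation of $\mathfrak g$ that acts on $V_k$ as multiplication by $\gamma^k$, and write $D_\gamma$ also for the dilation $\exp\circ D_\gamma\circ\exp^{-1}$ of $G$. Let $X_1,\dots,X_d$ be a basis of $\mathfrak g$ each of whose elements lies in some $V_k$, and put $$G_0=\exp(\mathcal{O}X_1+\dots+\mathcal{O}X_d),\qquad G_n=D_{\varpi^n}(G_0)\quad(n\in\mathbb{Z}).$$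 Let $dx$ be the Haar measure on $G$ with $|G_0|=1$ and let $|x|_G=|G_n|^{1/Q}$ if $x\in G_n\setminus G_{n+1}$, $|e|_G=0$. Let $1<r<s<\infty$ and $0<\lambda<Q$ be such that $\frac1s=\frac1r+\frac{\lambda}{Q}-1$. Then there is a constant $C$, independent of $f$, such that for every $f\in L^r(G)$ the integral $$(f*|\cdot|_G^{-\lambda})(x)=\int_G f(y)\,|y^{-1}x|_G^{-\lambda}\,dy$$ converges absolutely for almost every $x\in G$, the function $f*|\cdot|_G^{-\lambda}$ belongs to $L^s(G)$, and $$\|f*|\cdot|_G^{-\lambda}\|_{L^s(G)}\le C\,\|f\|_{L^r(G)}.$$ -/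

import Mathlib

open scoped ENNReal NNReal ValuativeRel
open MeasureTheory

noncomputable section

/-! ### The Baker-Campbell-Hausdorff product -/

section BCH

variable {L : Type*} [LieRing L]

/-- The right-nested iterated bracket `[a₁, [a₂, [..., [a_{N-1}, a_N]...]]]` of a word; a word with
one letter `a` gives `a`. -/
def nestedBracket : List L → L
  | [] => 0
  | [a] => a
  | a :: b :: l => ⁅a, nestedBracket (b :: l)⁆

/-- The word `X^{r₁} Y^{s₁} ⋯ X^{rₙ} Y^{sₙ}`. -/
def dynkinWord (X Y : L) {n : ℕ} (r s : Fin n → ℕ) : List L :=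
  (List.ofFn fun i => List.replicate (r i) X ++ List.replicate (s i) Y).flatten

variable (K : Type*) [Field K] [LieAlgebra K L]

/-- Dynkin's form of the Baker-Campbell-Hausdorff series `log (exp X exp Y)`, restricted to the terms
with at most `c` blocks `X^{rᵢ} Y^{sᵢ}` and all exponents at most `c`:
`∑ₙ (-1)^(n-1)/n ∑_{rᵢ + sᵢ > 0} [X^{r₁} Y^{s₁} ⋯ X^{rₙ} Y^{sₙ}] / (∑ᵢ (rᵢ+sᵢ) ∏ᵢ rᵢ! sᵢ!)`. -/
def bchTrunc (c : ℕ) (X Y : L) : L :=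
  ∑ n ∈ Finset.Icc 1 c,
    ∑ r ∈ Fintype.piFinset fun _ : Fin n => Finset.range (c + 1),
      ∑ s ∈ Fintype.piFinset fun _ : Fin n => Finset.range (c + 1),
        if ∀ i, 0 < r i + s i then
          ((-1 : K) ^ (n - 1) / ((n : K) * ((∑ i, (r i + s i) : ℕ) : K) *
            ∏ i, (((r i).factorial : K) * ((s i).factorial : K)))) •
            nestedBracket (dynkinWord X Y r s)
        else 0

/-- The Baker-Campbell-Hausdorff product `X ⋄ Y` on a nilpotent Lie algebra. All terms which are left
out contain an iterated bracket of more letters than the nilpotency class, so they vanish. -/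
def bch (X Y : L) : L := bchTrunc K (LieModule.nilpotencyLength L L) X Y

/-- `exp : L ≃ₜ G` exhibits the topological group `G` as the nilpotent `K`-Lie group with Lie algebra
`L` and exponential map `exp`, that is `G ≅ (L, ⋄)`. The first condition says that the
Baker-Campbell-Hausdorff formula makes sense; it always holds in characteristic zero. -/
structure IsExponentialMap [TopologicalSpace L] {G : Type*} [Group G] [TopologicalSpace G]
    (exp : L ≃ₜ G) : Prop where
  char_cond : ringChar K = 0 ∨ LieModule.nilpotencyLength L L < ringChar K
  exp_mul_exp : ∀ X Y : L, exp X * exp Y = exp (bch K X Y)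

end BCH

/-! ### Graded Lie algebras and their dilations -/

/-- A gradation `L = ⨁_{k ≥ 1} V_k`, `[V_i, V_j] ⊆ V_{i+j}`, of a Lie algebra. -/
structure LieGradation (K L : Type*) [Field K] [LieRing L] [LieAlgebra K L] where
  piece : ℕ → Submodule K L
  piece_zero : piece 0 = ⊥
  isInternal : DirectSum.IsInternal piece
  lie_mem : ∀ i j : ℕ, ∀ x ∈ piece i, ∀ y ∈ piece j, ⁅x, y⁆ ∈ piece (i + j)

namespace LieGradation

variable {K L : Type*} [Field K] [LieRing L] [LieAlgebra K L] (V : LieGradation K L)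

/-- The homogeneous dimension `Q = ∑ k, k * dim V_k`. -/
def homogeneousDim : ℕ := ∑ᶠ k : ℕ, k * Module.finrank K (V.piece k)

/-- The dilation `D_γ`: the linear map that is multiplication by `γ ^ k` on `V_k`. -/
def dilation (γ : K) : L →ₗ[K] L :=
  (DirectSum.toModule K ℕ L fun k => γ ^ k • (V.piece k).subtype) ∘ₗ
    (LinearEquiv.ofBijective (DirectSum.coeLinearMap V.piece) V.isInternal).symm.toLinearMap

theorem dilation_apply_of_mem (γ : K) {k : ℕ} {x : L} (hx : x ∈ V.piece k) :
    V.dilation γ x = γ ^ k • x := by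
  have h : (LinearEquiv.ofBijective (DirectSum.coeLinearMap V.piece) V.isInternal).symm x
      = DirectSum.lof K ℕ (fun k => V.piece k) k ⟨x, hx⟩ := by
    rw [LinearEquiv.symm_apply_eq]
    exact (DirectSum.coeLinearMap_lof V.piece k ⟨x, hx⟩).symm
  simp [dilation, h]

variable [TopologicalSpace L] {G : Type*} [TopologicalSpace G]

/-- The dilation of the group, `exp ∘ D_γ ∘ exp⁻¹`. -/
def groupDilation (exp : L ≃ₜ G) (γ : K) (x : G) : G := exp (V.dilation γ (exp.symm x))

variable [ValuativeRel K] {ι : Type*}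

/-- `G_0 = exp (𝒪 X_1 + ... + 𝒪 X_d)`. -/
def unitLattice (exp : L ≃ₜ G) (X : Module.Basis ι K L) : Set G :=
  exp '' {x : L | ∀ i, X.repr x i ∈ 𝒪[K]}

/-- `G_n = D_γ (G_0)` with `γ = ϖ ^ n`, for a uniformizer `ϖ`. -/
def filtration (exp : L ≃ₜ G) (X : Module.Basis ι K L) (ϖ : 𝒪[K]) (n : ℤ) : Set G :=
  V.groupDilation exp ((ϖ : K) ^ n) '' unitLattice exp X

end LieGradation

/-! ### Quasi-norm and convolution -/

/-- `|x|_𝒢 = |G_n|` (the measure of `G_n`) if `x ∈ G_n \ G_{n+1}`, and `0` if there is no such `n`.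
For a decreasing sequence of sets there is at most one such `n`. -/
def filtrationNorm {G : Type*} [MeasurableSpace G] (μ : Measure G) (H : ℤ → Set G) (x : G) : ℝ :=
  open Classical in
  if h : ∃ n : ℤ, x ∈ H n ∧ x ∉ H (n + 1) then μ.real (H h.choose) else 0

/-- The homogeneous quasi-norm `|x|_G = |x|_𝒢 ^ (1 / Q)` of a graded group. -/
def LieGradation.quasiNorm {K L : Type*} [Field K] [LieRing L] [LieAlgebra K L]
    (V : LieGradation K L) [TopologicalSpace L] {G : Type*} [TopologicalSpace G]
    [MeasurableSpace G] [ValuativeRel K] {ι : Type*} (exp : L ≃ₜ G) (X : Module.Basis ι K L)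
    (ϖ : 𝒪[K]) (μ : Measure G) (x : G) : ℝ :=
  filtrationNorm μ (V.filtration exp X ϖ) x ^ (1 / (V.homogeneousDim : ℝ))

/-- The convolution `(f * k)(x) = ∫ f(y) k(y⁻¹ x) dy` with a real kernel `k`. -/
def groupConvolution {G : Type*} [Group G] [MeasurableSpace G] (μ : Measure G)
    (f : G → ℂ) (k : G → ℝ) (x : G) : ℂ :=
  ∫ y, f y * ((k (y⁻¹ * x) : ℝ) : ℂ) ∂μ

end

/-! ### An elementary inequality -/

/-! With `α = λ/Q` and `|G_n| = e^{-nτ}`, the kernel equals `e^{αnτ}` on the shell `G_n \ G_{n+1}`.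
By duality it suffices to bound `∬ F(y) H(x) k(y⁻¹x)` for `‖F‖_r = ‖H‖_t = 1`, where `t = s'`, so
that `1/r + 1/t + α = 2`.

Put `x = r log F`, `y = t log H`, `w = nτ`. The integrand is then the exponential of a convex
combination of `x + y`, `x + w` and `y + w`. Plain AM-GM gives `F^r H^t + F^r e^w + H^t e^w`, which
just fails: every shell contributes about 1 to `∫ e^w`. But the weights are strictly positive, so
the combination stays below its largest term, and the gain `ε|w - x|` or `ε|w - y|` turns the
divergent sum over shells into a geometric series, uniformly in `F` and `H` (`Real.exp_weighted_le`,
`exists_lintegral_shellWeight_le`). Neither a maximal function nor interpolation is needed.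

The group enters only through the sizes of the shells and of their inverses. Dilations are
automorphisms, so they multiply Haar measure by a constant and commute with inversion; hence both
sizes decay like `e^{-nτ}`. No quasi-triangle inequality is used, and `τ` is never computed. -/

theorem Real.exp_weighted_le {a b d ε : ℝ} (ha : 0 < a) (hb : 0 < b) (hd : 0 < d)
    (hsum : a + b + d = 1) (hεa : ε ≤ a) (hεb : ε ≤ b) (hεd : ε ≤ d) (hε : 0 < ε) (x y w : ℝ) :
    Real.exp ((a + b) * x + (a + d) * y + (b + d) * w) ≤
      Real.exp (x + y) + Real.exp (x + w - ε * |w - x|) + Real.exp (y + w - ε * |w - y|) := by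
  have h1 := Real.exp_pos (x + y)
  have h2 := Real.exp_pos (x + w - ε * |w - x|)
  have h3 := Real.exp_pos (y + w - ε * |w - y|)
  obtain rfl : a = 1 - b - d := by linarith
  -- The left side is `a(x+y) + b(x+w) + d(y+w)`. If `w` is smallest, it is at most `x + y`, and no
  -- gain is needed. If `y` is smallest, it equals `(x+w) - a(w-y) - d(x-y)`, and `|w - x|` is at
  -- most the larger of the two nonnegative differences. The case of smallest `x` is symmetric.
  have key : ((1 - b - d) + b) * x + ((1 - b - d) + d) * y + (b + d) * w ≤ x + y ∨
      ((1 - b - d) + b) * x + ((1 - b - d) + d) * y + (b + d) * w ≤ x + w - ε * |w - x| ∨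
      ((1 - b - d) + b) * x + ((1 - b - d) + d) * y + (b + d) * w ≤ y + w - ε * |w - y| := by
    rcases le_total w x with hx | hx <;> rcases le_total w y with hy | hy
    · left; nlinarith
    · right; left
      rw [abs_of_nonpos (by linarith)]
      nlinarith [mul_nonneg (sub_nonneg.2 hεd) (sub_nonneg.2 hx),
        mul_nonneg ha.le (sub_nonneg.2 hy), mul_nonneg hd.le (sub_nonneg.2 hy)]
    · right; right
      rw [abs_of_nonpos (by linarith)]
      nlinarith [mul_nonneg (sub_nonneg.2 hεb) (sub_nonneg.2 hy),
        mul_nonneg ha.le (sub_nonneg.2 hx), mul_nonneg hb.le (sub_nonneg.2 hx)]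
    · rcases le_total x y with hxy | hxy
      · right; right
        rw [abs_of_nonneg (by linarith)]
        nlinarith [mul_nonneg (sub_nonneg.2 hεa) (sub_nonneg.2 hy),
          mul_nonneg (sub_nonneg.2 hεb) (sub_nonneg.2 hxy),
          mul_nonneg hε.le (sub_nonneg.2 hxy), mul_nonneg ha.le (sub_nonneg.2 hx)]
      · right; left
        rw [abs_of_nonneg (by linarith)]
        nlinarith [mul_nonneg (sub_nonneg.2 hεa) (sub_nonneg.2 hx),
          mul_nonneg (sub_nonneg.2 hεd) (sub_nonneg.2 hxy),
          mul_nonneg hε.le (sub_nonneg.2 hxy), mul_nonneg ha.le (sub_nonneg.2 hy)]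
  rcases key with h | h | h <;> have := Real.exp_le_exp.2 h <;> linarith

/-- Uniformity in `ξ` comes from translation by the integer `⌊ξ⌋`; the fractional part costs at most
a factor `e^δ`. -/
theorem exists_tsum_exp_neg_abs_le {δ : ℝ} (hδ : 0 < δ) :
    ∃ C : ℝ≥0, ∀ ξ : ℝ, ∑' n : ℤ, ENNReal.ofReal (Real.exp (-(δ * |(n : ℝ) - ξ|))) ≤ C := by
  have hs : Summable fun n : ℤ => Real.exp (δ * (1 - |(n : ℝ)|)) := by
    have h0 : Summable fun n : ℕ => Real.exp (δ * (1 - n)) := by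
      have := (Real.summable_exp_nat_mul_iff.2 (neg_lt_zero.2 hδ)).mul_left (Real.exp δ)
      refine this.congr fun n => ?_
      rw [← Real.exp_add]; ring_nf
    refine Summable.of_nat_of_neg ?_ ?_ <;> simpa using h0
  refine ⟨(∑' n : ℤ, Real.exp (δ * (1 - |(n : ℝ)|))).toNNReal, fun ξ => ?_⟩
  calc ∑' n : ℤ, ENNReal.ofReal (Real.exp (-(δ * |(n : ℝ) - ξ|)))
      ≤ ∑' n : ℤ, ENNReal.ofReal (Real.exp (δ * (1 - |((n - ⌊ξ⌋ : ℤ) : ℝ)|))) := by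
        refine ENNReal.tsum_le_tsum fun n => ENNReal.ofReal_le_ofReal (Real.exp_le_exp.2 ?_)
        have h1 := Int.floor_le ξ
        have h2 := Int.lt_floor_add_one ξ
        have h3 : |((n - ⌊ξ⌋ : ℤ) : ℝ)| ≤ |(n : ℝ) - ξ| + 1 := by
          push_cast
          calc |(n : ℝ) - ⌊ξ⌋| = |((n : ℝ) - ξ) + (ξ - ⌊ξ⌋)| := by ring_nf
            _ ≤ |(n : ℝ) - ξ| + |ξ - ⌊ξ⌋| := abs_add_le _ _
            _ ≤ _ := by rw [abs_of_nonneg (sub_nonneg.2 h1)]; linarith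
        nlinarith
    _ = ∑' n : ℤ, ENNReal.ofReal (Real.exp (δ * (1 - |(n : ℝ)|))) :=
        (Equiv.subRight ⌊ξ⌋).tsum_eq
          fun n : ℤ => ENNReal.ofReal (Real.exp (δ * (1 - |(n : ℝ)|)))
    _ = _ := by
        rw [← ENNReal.ofReal_tsum_of_nonneg (fun _ => (Real.exp_pos _).le) hs]; rfl

/-! ### Duality for the Lebesgue integral -/

theorem lintegral_rpow_le_of_forall_lintegral_mul_le {X : Type*} [MeasurableSpace X]
    {μ : Measure X} [SigmaFinite μ] {s s' : ℝ} (h : s.HolderConjugate s') {u : X → ℝ≥0∞}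
    {C : ℝ≥0∞}
    (hC : ∀ H : X → ℝ≥0, Measurable H → ∫⁻ x, (H x : ℝ≥0∞) ^ s' ∂μ ≤ 1 →
      ∫⁻ x, u x * H x ∂μ ≤ C) :
    ∫⁻ x, u x ^ s ∂μ ≤ C ^ s := by
  have hs := h.pos
  have hs' := h.symm.pos
  refine le_of_forall_lt fun L hL => ?_
  rw [lintegral_eq_nnreal, lt_iSup_iff] at hL
  obtain ⟨φ, hL⟩ := hL
  rw [lt_iSup_iff] at hL
  obtain ⟨hφ, hL⟩ := hL
  rw [← SimpleFunc.lintegral_eq_lintegral] at hL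
  -- σ-finiteness provides a minorant of finite integral, so normalizing by `J` is legitimate even
  -- if `∫ u ^ s` is infinite.
  obtain ⟨g, hgφ, hgfin, hLg⟩ :=
    SimpleFunc.exists_lt_lintegral_simpleFunc_of_lt_lintegral (f := φ) hL
  have hgu : ∀ x, ((g x : ℝ≥0) : ℝ≥0∞) ≤ u x ^ s := fun x =>
    (ENNReal.coe_le_coe.2 (hgφ x)).trans (hφ x)
  refine hLg.trans_le ?_
  set J : ℝ≥0∞ := ∫⁻ x, g x ∂μ with hJ
  rcases eq_or_ne J 0 with hJ0 | hJ0
  · simp [hJ0]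
  have hJt : J ≠ ∞ := hgfin.ne
  set j : ℝ≥0 := J.toNNReal with hj
  have hjJ : (j : ℝ≥0∞) = J := ENNReal.coe_toNNReal hJt
  have hj0 : j ≠ 0 := fun h0 => hJ0 (by rw [← hjJ, h0, ENNReal.coe_zero])
  have hgm : Measurable fun x => (g x : ℝ≥0∞) := g.measurable.coe_nnreal_ennreal
  have hint : ∫⁻ x, ((g x / j : ℝ≥0) : ℝ≥0∞) ∂μ = 1 := by
    simp_rw [ENNReal.coe_div hj0, div_eq_mul_inv]
    rw [lintegral_mul_const _ hgm, hjJ, ← hJ, ENNReal.mul_inv_cancel hJ0 hJt]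
  -- The extremal test function for Hölder's inequality: `J ^ (1/s) * (g/J) = g ^ (1/s) * (g/J) ^
  -- (1/s') ≤ u * H`.
  have key := hC (fun x => (g x / j) ^ (1 / s')) ((g.measurable.div_const j).pow_const _) (by
    rw [← hint]
    refine (lintegral_congr fun x => ?_).le
    rw [← ENNReal.coe_rpow_of_nonneg _ hs'.le, ← NNReal.rpow_mul, one_div_mul_cancel hs'.ne',
      NNReal.rpow_one])
  have hlow : J ^ (1 / s) ≤ C := by
    refine le_trans ?_ key
    calc J ^ (1 / s) = ∫⁻ x, (j : ℝ≥0∞) ^ (1 / s) * ((g x / j : ℝ≥0) : ℝ≥0∞) ∂μ := by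
          rw [lintegral_const_mul _ (g.measurable.div_const j).coe_nnreal_ennreal, hint, mul_one,
            hjJ]
      _ ≤ _ := by
          refine lintegral_mono fun x => ?_
          have hux : ((g x : ℝ≥0) : ℝ≥0∞) ^ (1 / s) ≤ u x := by
            have := ENNReal.rpow_le_rpow (hgu x) (one_div_pos.2 hs).le
            rwa [← ENNReal.rpow_mul, mul_one_div_cancel hs.ne', ENNReal.rpow_one] at this
          refine le_trans (le_of_eq ?_) (mul_le_mul_left hux _)
          rw [← ENNReal.coe_rpow_of_nonneg _ (one_div_pos.2 hs).le,
            ← ENNReal.coe_rpow_of_nonneg _ (one_div_pos.2 hs).le, ← ENNReal.coe_mul,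
            ← ENNReal.coe_mul, ENNReal.coe_inj]
          have : g x = j * (g x / j) := by field_simp
          have h1 : (1 / s + 1 / s' : ℝ) = 1 := by
            simpa [one_div] using h.inv_add_inv_eq_one
          conv_rhs => rw [this]
          rw [mul_div_cancel_left₀ _ hj0, NNReal.mul_rpow, mul_assoc]
          rw [← NNReal.rpow_add_of_nonneg _ (one_div_pos.2 hs).le (one_div_pos.2 hs').le, h1,
            NNReal.rpow_one]
  calc J = (J ^ (1 / s)) ^ s := by
        rw [← ENNReal.rpow_mul, one_div_mul_cancel hs.ne', ENNReal.rpow_one]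
    _ ≤ C ^ s := ENNReal.rpow_le_rpow hlow hs.le

/-! ### The Hardy-Littlewood-Sobolev inequality for a kernel adapted to shells of geometric size -/

section HLS

variable {G : Type*}

/-- `∑ₙ e^{nτ} e^{-ε|nτ - ξ|} 1_{Sₙ}`: the kernel whose height on the shell `Sₙ` is `e^{nτ}`, damped
away from height `e^ξ`. -/
noncomputable def shellWeight (S : ℤ → Set G) (τ ε ξ : ℝ) (z : G) : ℝ≥0∞ :=
  ∑' n : ℤ, (S n).indicator (fun _ => ENNReal.ofReal (Real.exp (n * τ - ε * |n * τ - ξ|))) z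

theorem le_shellWeight {S : ℤ → Set G} (τ ε ξ : ℝ) {z : G} {n : ℤ} (hz : z ∈ S n) :
    ENNReal.ofReal (Real.exp (n * τ - ε * |n * τ - ξ|)) ≤ shellWeight S τ ε ξ z := by
  refine le_trans (le_of_eq ?_) (ENNReal.le_tsum n)
  rw [Set.indicator_of_mem hz]

theorem Measurable.shellWeight [MeasurableSpace G] {X : Type*} [MeasurableSpace X]
    {S : ℤ → Set G} (hS : ∀ n, MeasurableSet (S n)) (τ ε : ℝ) {ξ : X → ℝ} (hξ : Measurable ξ)
    {z : X → G} (hz : Measurable z) : Measurable fun x => shellWeight S τ ε (ξ x) (z x) := by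
  refine Measurable.tsum fun n => ?_
  have : (fun x => (S n).indicator
      (fun _ => ENNReal.ofReal (Real.exp (n * τ - ε * |n * τ - ξ x|))) (z x)) =
      (z ⁻¹' S n).indicator
        fun x => ENNReal.ofReal (Real.exp (n * τ - ε * |n * τ - ξ x|)) := rfl
  rw [this]
  exact Measurable.indicator (by fun_prop) (hz (hS n))

/-- The factor `e^{nτ}` cancels the measure of `Sₙ`, leaving only the damping, a two-sided geometric
series centred at `ξ/τ`. The constant depends only on `τ`, `ε`, `A`, because it has to serve both
the shells and their inverses. -/
theorem exists_lintegral_shellWeight_le [MeasurableSpace G] {τ ε : ℝ} (hτ : 0 < τ)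
    (hε : 0 < ε) (A : ℝ≥0) :
    ∃ C : ℝ≥0, ∀ (μ : Measure G) (S : ℤ → Set G), (∀ n, MeasurableSet (S n)) →
      (∀ n, μ (S n) ≤ A * ENNReal.ofReal (Real.exp (-(n * τ)))) →
      ∀ ξ, ∫⁻ z, shellWeight S τ ε ξ z ∂μ ≤ C := by
  obtain ⟨C, hC⟩ := exists_tsum_exp_neg_abs_le (mul_pos hε hτ)
  refine ⟨A * C, fun μ S hSm hS ξ => ?_⟩
  unfold shellWeight
  rw [lintegral_tsum fun n => (measurable_const.indicator (hSm n)).aemeasurable]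
  simp_rw [fun n => lintegral_indicator_const (μ := μ) (hSm n)
    (ENNReal.ofReal (Real.exp (n * τ - ε * |n * τ - ξ|)))]
  calc ∑' n : ℤ, ENNReal.ofReal (Real.exp (n * τ - ε * |n * τ - ξ|)) * μ (S n)
      ≤ ∑' n : ℤ, (A : ℝ≥0∞) * ENNReal.ofReal (Real.exp (-(ε * τ * |(n : ℝ) - ξ / τ|))) := by
        refine ENNReal.tsum_le_tsum fun n => ?_
        refine (mul_le_mul_right (hS n) _).trans (le_of_eq ?_)
        rw [mul_left_comm, ← ENNReal.ofReal_mul (Real.exp_pos _).le, ← Real.exp_add]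
        congr 3
        have : (n : ℝ) * τ - ξ = τ * (n - ξ / τ) := by field_simp
        rw [this, abs_mul, abs_of_pos hτ]
        ring
    _ = (A : ℝ≥0∞) * ∑' n : ℤ, ENNReal.ofReal (Real.exp (-(ε * τ * |(n : ℝ) - ξ / τ|))) :=
        ENNReal.tsum_mul_left
    _ ≤ _ := by rw [ENNReal.coe_mul]; exact mul_le_mul_right (hC _) _

/-- `IsShellKernel S τ α k`: at each point `k` vanishes or has the value `e^{αnτ}` of a
shell `Sₙ` containing the point. -/
def IsShellKernel (S : ℤ → Set G) (τ α : ℝ) (k : G → ℝ≥0∞) : Prop :=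
  ∀ z, k z = 0 ∨ ∃ n : ℤ, z ∈ S n ∧ k z = ENNReal.ofReal (Real.exp (α * (n * τ)))

theorem mul_mul_shellKernel_le {S : ℤ → Set G} {τ α r t ε : ℝ} {k : G → ℝ≥0∞}
    (hk : IsShellKernel S τ α k) (hr : 0 < r) (ht : 0 < t) (hsum : 1 / r + 1 / t + α = 2)
    (hε : 0 < ε) (hεα : ε ≤ 1 - α) (hεr : ε ≤ 1 - 1 / r) (hεt : ε ≤ 1 - 1 / t)
    (a b : ℝ≥0) (z : G) :
    (a : ℝ≥0∞) * b * k z ≤ (a : ℝ≥0∞) ^ r * (b : ℝ≥0∞) ^ t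
      + (a : ℝ≥0∞) ^ r * shellWeight S τ ε (r * Real.log a) z
      + (b : ℝ≥0∞) ^ t * shellWeight S τ ε (t * Real.log b) z := by
  rcases hk z with h0 | ⟨n, hzn, hkz⟩
  · simp [h0]
  rcases eq_or_ne a 0 with rfl | ha
  · simp
  rcases eq_or_ne b 0 with rfl | hb
  · simp
  have ha' : (0 : ℝ) < a := by exact_mod_cast pos_iff_ne_zero.2 ha
  have hb' : (0 : ℝ) < b := by exact_mod_cast pos_iff_ne_zero.2 hb
  have hexp : ∀ (c : ℝ≥0), (0 : ℝ) < c → (c : ℝ≥0∞) = ENNReal.ofReal (Real.exp (Real.log c)) := by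
    intro c hc
    rw [Real.exp_log hc, ENNReal.ofReal_coe_nnreal]
  have hpow : ∀ (c : ℝ≥0) (u : ℝ), (0 : ℝ) < c →
      (c : ℝ≥0∞) ^ u = ENNReal.ofReal (Real.exp (u * Real.log c)) := by
    intro c u hc
    rw [hexp c hc, ENNReal.ofReal_rpow_of_pos (Real.exp_pos _), ← Real.exp_mul, mul_comm]
  -- The weights sum to `3 - 2 = 1`, and their pairwise sums are `1/r`, `1/t` and `α`, the exponents
  -- that recover `a`, `b` and `k z`.
  have key := Real.exp_weighted_le (a := 1 - α) (b := 1 - 1 / t) (d := 1 - 1 / r) (ε := ε)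
    (by linarith) (by linarith) (by linarith) (by linarith) hεα hεt hεr hε
    (r * Real.log a) (t * Real.log b) (n * τ)
  have hL : (a : ℝ≥0∞) * b * k z = ENNReal.ofReal (Real.exp
      ((1 - α + (1 - 1 / t)) * (r * Real.log a) + (1 - α + (1 - 1 / r)) * (t * Real.log b)
        + (1 - 1 / t + (1 - 1 / r)) * (n * τ))) := by
    rw [hkz, hexp a ha', hexp b hb', ← ENNReal.ofReal_mul (Real.exp_pos _).le, ← Real.exp_add,
      ← ENNReal.ofReal_mul (Real.exp_pos _).le, ← Real.exp_add]
    have e1 : 1 - α + (1 - 1 / t) = 1 / r := by linarith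
    have e2 : 1 - α + (1 - 1 / r) = 1 / t := by linarith
    have e3 : 1 - 1 / t + (1 - 1 / r) = α := by linarith
    rw [e1, e2, e3, ← mul_assoc (1 / r), ← mul_assoc (1 / t), one_div_mul_cancel hr.ne',
      one_div_mul_cancel ht.ne', one_mul, one_mul]
  rw [hL]
  refine (ENNReal.ofReal_le_ofReal key).trans ?_
  rw [ENNReal.ofReal_add (by positivity) (by positivity), ENNReal.ofReal_add (by positivity)
    (by positivity), hpow a r ha', hpow b t hb']
  gcongr
  · rw [Real.exp_add, ENNReal.ofReal_mul (Real.exp_pos _).le]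
  · rw [add_sub_assoc, Real.exp_add, ENNReal.ofReal_mul (Real.exp_pos _).le]
    gcongr
    exact le_shellWeight τ ε _ hzn
  · rw [add_sub_assoc, Real.exp_add, ENNReal.ofReal_mul (Real.exp_pos _).le]
    gcongr
    exact le_shellWeight τ ε _ hzn

variable [MeasurableSpace G] [Group G] [MeasurableMul₂ G] [MeasurableInv G]

/-- The pointwise bound is integrated term by term. In each damped term the shift `ξ` depends on one
variable only, so the other can be integrated first with a uniform bound. The kernel itself need not
be measurable, since its majorants are. -/
theorem exists_lintegral_lintegral_mul_shellKernel_le (μ : Measure G) [SFinite μ]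
    [μ.IsMulLeftInvariant] {S : ℤ → Set G} (hSm : ∀ n, MeasurableSet (S n)) {τ : ℝ} (hτ : 0 < τ)
    {A : ℝ≥0} (hS : ∀ n, μ (S n) ≤ A * ENNReal.ofReal (Real.exp (-(n * τ))))
    (hSinv : ∀ n, μ (Inv.inv ⁻¹' S n) ≤ A * ENNReal.ofReal (Real.exp (-(n * τ))))
    {r t α : ℝ} (hr : 1 < r) (ht : 1 < t) (hα : α < 1) (hsum : 1 / r + 1 / t + α = 2) :
    ∃ C : ℝ≥0, ∀ k : G → ℝ≥0∞, IsShellKernel S τ α k →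
      ∀ F H : G → ℝ≥0, Measurable F → Measurable H →
      ∫⁻ x, (F x : ℝ≥0∞) ^ r ∂μ ≤ 1 → ∫⁻ x, (H x : ℝ≥0∞) ^ t ∂μ ≤ 1 →
      ∫⁻ x, ∫⁻ y, (F y : ℝ≥0∞) * H x * k (y⁻¹ * x) ∂μ ∂μ ≤ C := by
  have hr0 : 0 < r := by linarith
  have ht0 : 0 < t := by linarith
  have hr1 : 0 < 1 - 1 / r := by rw [sub_pos, div_lt_one hr0]; exact hr
  have ht1 : 0 < 1 - 1 / t := by rw [sub_pos, div_lt_one ht0]; exact ht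
  obtain ⟨ε, hε, hεα, hεr, hεt⟩ :
      ∃ ε : ℝ, 0 < ε ∧ ε ≤ 1 - α ∧ ε ≤ 1 - 1 / r ∧ ε ≤ 1 - 1 / t :=
    ⟨min (1 - α) (min (1 - 1 / r) (1 - 1 / t)), by
      simp only [lt_min_iff]; exact ⟨by linarith, hr1, ht1⟩, min_le_left _ _,
      (min_le_right _ _).trans (min_le_left _ _), (min_le_right _ _).trans (min_le_right _ _)⟩
  obtain ⟨B, hB⟩ := exists_lintegral_shellWeight_le (G := G) hτ hε A
  refine ⟨1 + B + B, fun k hk F H hF hH hFr hHt => ?_⟩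
  have hFm : Measurable fun x => (F x : ℝ≥0∞) ^ r := hF.coe_nnreal_ennreal.pow_const r
  have hHm : Measurable fun x => (H x : ℝ≥0∞) ^ t := hH.coe_nnreal_ennreal.pow_const t
  have hlogF : Measurable fun y => r * Real.log (F y) := by fun_prop
  have hdiv : Measurable fun p : G × G => p.2⁻¹ * p.1 := measurable_snd.inv.mul measurable_fst
  have hm1 : Measurable fun p : G × G => (F p.2 : ℝ≥0∞) ^ r * (H p.1 : ℝ≥0∞) ^ t :=
    (hFm.comp measurable_snd).mul (hHm.comp measurable_fst)
  have hm2 : Measurable fun p : G × G => (F p.2 : ℝ≥0∞) ^ r *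
      shellWeight S τ ε (r * Real.log (F p.2)) (p.2⁻¹ * p.1) :=
    (hFm.comp measurable_snd).mul
      (Measurable.shellWeight hSm τ ε (hlogF.comp measurable_snd) hdiv)
  have b1 : ∫⁻ x, ∫⁻ y, (F y : ℝ≥0∞) ^ r * (H x : ℝ≥0∞) ^ t ∂μ ∂μ ≤ 1 := by
    simp_rw [fun x => lintegral_mul_const (μ := μ) ((H x : ℝ≥0∞) ^ t) hFm]
    rw [lintegral_const_mul _ hHm]
    exact mul_le_one' hFr hHt
  have b2 : ∫⁻ x, ∫⁻ y, (F y : ℝ≥0∞) ^ r *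
      shellWeight S τ ε (r * Real.log (F y)) (y⁻¹ * x) ∂μ ∂μ ≤ B := by
    rw [lintegral_lintegral_swap hm2.aemeasurable]
    calc _ ≤ ∫⁻ y, (F y : ℝ≥0∞) ^ r * B ∂μ := by
          refine lintegral_mono fun y => ?_
          rw [lintegral_const_mul _ (Measurable.shellWeight hSm τ ε measurable_const
            (measurable_const_mul _)),
            lintegral_mul_left_eq_self (fun z => shellWeight S τ ε (r * Real.log (F y)) z)]
          gcongr
          exact hB μ S hSm hS _
      _ ≤ B := by
          rw [lintegral_mul_const _ hFm]
          exact mul_le_of_le_one_left' hFr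
  have b3 : ∫⁻ x, ∫⁻ y, (H x : ℝ≥0∞) ^ t *
      shellWeight S τ ε (t * Real.log (H x)) (y⁻¹ * x) ∂μ ∂μ ≤ B := by
    calc _ ≤ ∫⁻ x, (H x : ℝ≥0∞) ^ t * B ∂μ := by
          refine lintegral_mono fun x => ?_
          rw [lintegral_const_mul _ (Measurable.shellWeight hSm τ ε measurable_const
            (measurable_inv.mul_const _)),
            ← lintegral_mul_left_eq_self (fun y => shellWeight S τ ε _ (y⁻¹ * x)) x]
          gcongr
          -- After the substitution `y ↦ x * y` the weight is evaluated at `y⁻¹`. The bound on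
          -- inverted shells thus takes the place of unimodularity.
          have e : ∀ y : G, shellWeight S τ ε (t * Real.log (H x)) ((x * y)⁻¹ * x) =
              shellWeight (fun n => Inv.inv ⁻¹' S n) τ ε (t * Real.log (H x)) y := by
            intro y
            rw [mul_inv_rev, inv_mul_cancel_right]
            rfl
          simp_rw [e]
          exact hB μ _ (fun n => measurable_inv (hSm n)) hSinv _
      _ ≤ B := by
          rw [lintegral_mul_const _ hHm]
          exact mul_le_of_le_one_left' hHt
  have hadd : ∀ {f g : G × G → ℝ≥0∞}, Measurable f →
      ∫⁻ x, ∫⁻ y, (f (x, y) + g (x, y)) ∂μ ∂μ =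
        (∫⁻ x, ∫⁻ y, f (x, y) ∂μ ∂μ) + ∫⁻ x, ∫⁻ y, g (x, y) ∂μ ∂μ := by
    intro f g hf
    rw [← lintegral_add_left hf.lintegral_prod_right']
    exact lintegral_congr fun x => lintegral_add_left (hf.comp measurable_prodMk_left) _
  calc _ ≤ ∫⁻ x, ∫⁻ y, ((F y : ℝ≥0∞) ^ r * (H x : ℝ≥0∞) ^ t
      + (F y : ℝ≥0∞) ^ r * shellWeight S τ ε (r * Real.log (F y)) (y⁻¹ * x)
      + (H x : ℝ≥0∞) ^ t * shellWeight S τ ε (t * Real.log (H x)) (y⁻¹ * x)) ∂μ ∂μ :=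
        lintegral_mono fun x => lintegral_mono fun y =>
          mul_mul_shellKernel_le hk hr0 ht0 hsum hε hεα hεr hεt (F y) (H x) (y⁻¹ * x)
    _ = (∫⁻ x, ∫⁻ y, (F y : ℝ≥0∞) ^ r * (H x : ℝ≥0∞) ^ t ∂μ ∂μ)
      + (∫⁻ x, ∫⁻ y, (F y : ℝ≥0∞) ^ r *
          shellWeight S τ ε (r * Real.log (F y)) (y⁻¹ * x) ∂μ ∂μ)
      + ∫⁻ x, ∫⁻ y, (H x : ℝ≥0∞) ^ t *
          shellWeight S τ ε (t * Real.log (H x)) (y⁻¹ * x) ∂μ ∂μ := by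
        rw [← hadd (g := fun p => (F p.2 : ℝ≥0∞) ^ r *
            shellWeight S τ ε (r * Real.log (F p.2)) (p.2⁻¹ * p.1)) hm1]
        exact hadd (g := fun p => (H p.1 : ℝ≥0∞) ^ t *
          shellWeight S τ ε (t * Real.log (H p.1)) (p.2⁻¹ * p.1)) (hm1.add hm2)
    _ ≤ _ := by push_cast; gcongr

/-- The Hardy-Littlewood-Sobolev inequality for nonnegative functions and shell kernels. -/
theorem exists_lintegral_shellKernel_rpow_le (μ : Measure G) [SigmaFinite μ]
    [μ.IsMulLeftInvariant] {S : ℤ → Set G} (hSm : ∀ n, MeasurableSet (S n)) {τ : ℝ} (hτ : 0 < τ)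
    {A : ℝ≥0} (hS : ∀ n, μ (S n) ≤ A * ENNReal.ofReal (Real.exp (-(n * τ))))
    (hSinv : ∀ n, μ (Inv.inv ⁻¹' S n) ≤ A * ENNReal.ofReal (Real.exp (-(n * τ))))
    {r s α : ℝ} (hr : 1 < r) (hs : 1 < s) (hα : α < 1) (hsum : 1 / s = 1 / r + α - 1) :
    ∃ C : ℝ≥0, ∀ k : G → ℝ≥0∞, Measurable k → IsShellKernel S τ α k →
      ∀ F : G → ℝ≥0, Measurable F → ∫⁻ x, (F x : ℝ≥0∞) ^ r ∂μ ≠ ∞ →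
      ∫⁻ x, (∫⁻ y, F y * k (y⁻¹ * x) ∂μ) ^ s ∂μ ≤
        (C * (∫⁻ x, (F x : ℝ≥0∞) ^ r ∂μ) ^ (1 / r)) ^ s := by
  have hr0 : 0 < r := by linarith
  have hs0 : 0 < s := by linarith
  have hconj := Real.HolderConjugate.conjExponent hs
  set t := s.conjExponent with ht
  have hst : 1 / s + 1 / t = 1 := by simpa [one_div] using hconj.inv_add_inv_eq_one
  obtain ⟨C, hC⟩ := exists_lintegral_lintegral_mul_shellKernel_le μ hSm hτ hS hSinv hr
    hconj.symm.lt hα (by linarith : 1 / r + 1 / t + α = 2)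
  refine ⟨C, fun k hkm hk F hF hFr => ?_⟩
  have hFm : Measurable fun x => (F x : ℝ≥0∞) ^ r := hF.coe_nnreal_ennreal.pow_const r
  set J : ℝ≥0∞ := ∫⁻ x, (F x : ℝ≥0∞) ^ r ∂μ with hJ
  have hkt : ∀ x : G, Measurable fun y => k (y⁻¹ * x) := fun x =>
    hkm.comp (measurable_inv.mul_const x)
  have hFk : ∀ x : G, Measurable fun y => (F y : ℝ≥0∞) * k (y⁻¹ * x) := fun x =>
    hF.coe_nnreal_ennreal.mul (hkt x)
  rcases eq_or_ne J 0 with hJ0 | hJ0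
  · rw [hJ, lintegral_eq_zero_iff hFm] at hJ0
    have h0 : ∀ x, ∫⁻ y, F y * k (y⁻¹ * x) ∂μ = 0 := by
      intro x
      rw [lintegral_eq_zero_iff (hFk x)]
      filter_upwards [hJ0] with y hy
      have : F y = 0 := by
        have := (ENNReal.rpow_eq_zero_iff_of_pos hr0).1 hy
        exact_mod_cast this
      simp [this]
    simp [h0, hs0]
  -- `T` is the `L^r` norm of `F`; dividing by it reduces to the normalized case by homogeneity.
  set T : ℝ≥0 := (J ^ (1 / r)).toNNReal with hT
  have hTJ : (T : ℝ≥0∞) = J ^ (1 / r) :=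
    ENNReal.coe_toNNReal (ENNReal.rpow_ne_top_of_nonneg (one_div_pos.2 hr0).le hFr)
  have hTr : (T : ℝ≥0∞) ^ r = J := by
    rw [hTJ, ← ENNReal.rpow_mul, one_div_mul_cancel hr0.ne', ENNReal.rpow_one]
  have hT0 : T ≠ 0 := by
    rintro h
    rw [h, ENNReal.coe_zero, ENNReal.zero_rpow_of_pos hr0] at hTr
    exact hJ0 hTr.symm
  rw [← hTJ]
  have hnorm : ∫⁻ x, ((F x / T : ℝ≥0) : ℝ≥0∞) ^ r ∂μ ≤ 1 := by
    have e : ∀ x, ((F x / T : ℝ≥0) : ℝ≥0∞) ^ r = (F x : ℝ≥0∞) ^ r * J⁻¹ := by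
      intro x
      rw [ENNReal.coe_div hT0, ENNReal.div_rpow_of_nonneg _ _ hr0.le, hTr, div_eq_mul_inv]
    simp_rw [e]
    rw [lintegral_mul_const _ hFm, ← hJ, ENNReal.mul_inv_cancel hJ0 hFr]
  refine lintegral_rpow_le_of_forall_lintegral_mul_le hconj fun H hH hHt => ?_
  have := hC k hk (fun x => F x / T) H (hF.div_const T) hH hnorm hHt
  calc ∫⁻ x, (∫⁻ y, F y * k (y⁻¹ * x) ∂μ) * H x ∂μ
      = ∫⁻ x, ∫⁻ y, T * (((F y / T : ℝ≥0) : ℝ≥0∞) * H x * k (y⁻¹ * x)) ∂μ ∂μ := by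
        refine lintegral_congr fun x => ?_
        rw [← lintegral_mul_const _ (hFk x)]
        refine lintegral_congr fun y => ?_
        have : (F y : ℝ≥0∞) = T * ((F y / T : ℝ≥0) : ℝ≥0∞) := by
          rw [← ENNReal.coe_mul, mul_div_cancel₀ _ hT0]
        rw [this]
        ring
    _ = T * ∫⁻ x, ∫⁻ y, ((F y / T : ℝ≥0) : ℝ≥0∞) * H x * k (y⁻¹ * x) ∂μ ∂μ := by
        simp_rw [lintegral_const_mul' (T : ℝ≥0∞) _ ENNReal.coe_ne_top]
    _ ≤ C * T := by rw [mul_comm]; gcongr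

end HLS

/-! ### Dilations are automorphisms -/

section Bracket

variable {K L M : Type*} [Field K] [LieRing L] [LieAlgebra K L] [LieRing M] [LieAlgebra K M]

theorem map_nestedBracket (D : L →ₗ⁅K⁆ M) (l : List L) :
    D (nestedBracket l) = nestedBracket (l.map D) := by
  induction l with
  | nil => simp [nestedBracket]
  | cons a l ih =>
    cases l with
    | nil => simp [nestedBracket]
    | cons b l => simpa [nestedBracket] using congrArg (fun z => ⁅D a, z⁆) ih

theorem map_dynkinWord {L M : Type*} [LieRing L] [LieRing M] (D : L → M) (X Y : L)
    {n : ℕ} (r s : Fin n → ℕ) :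
    (dynkinWord X Y r s).map D = dynkinWord (D X) (D Y) r s := by
  simp [dynkinWord, List.map_flatten, List.map_ofFn, Function.comp_def]

/-- The series is a linear combination of iterated brackets, with coefficients that do not depend on
`X` and `Y`. -/
theorem map_bchTrunc (D : L →ₗ⁅K⁆ M) (c : ℕ) (X Y : L) :
    D (bchTrunc K c X Y) = bchTrunc K c (D X) (D Y) := by
  unfold bchTrunc
  simp only [map_sum]
  refine Finset.sum_congr rfl fun n _ => Finset.sum_congr rfl fun r _ =>
    Finset.sum_congr rfl fun s _ => ?_
  split_ifs
  · rw [map_smul, map_nestedBracket, map_dynkinWord]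
  · exact map_zero D

theorem map_bch (D : L →ₗ⁅K⁆ L) (X Y : L) : D (bch K X Y) = bch K (D X) (D Y) :=
  map_bchTrunc D _ X Y

end Bracket

namespace LieGradation

section Algebra

variable {K L : Type*} [Field K] [LieRing L] [LieAlgebra K L] (V : LieGradation K L)

theorem linearMap_ext {M : Type*} [AddCommGroup M] [Module K M] {f g : L →ₗ[K] M}
    (h : ∀ k, ∀ x ∈ V.piece k, f x = g x) : f = g := by
  refine LinearMap.ext fun x => ?_
  have hx : x ∈ ⨆ k, V.piece k := by rw [V.isInternal.submodule_iSup_eq_top]; trivial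
  induction hx using Submodule.iSup_induction' with
  | mem k x hx => exact h k x hx
  | zero => simp
  | add x y _ _ hx hy => rw [map_add, map_add, hx, hy]

/-- By bilinearity it is enough to take `x ∈ V_i`, `y ∈ V_j`, where both sides are `γ ^ (i + j) •
⁅x, y⁆`. -/
theorem dilation_lie (γ : K) (x y : L) :
    V.dilation γ ⁅x, y⁆ = ⁅V.dilation γ x, V.dilation γ y⁆ := by
  let B : L →ₗ[K] L →ₗ[K] L :=
    LinearMap.mk₂ K (fun x y => ⁅x, y⁆) add_lie smul_lie lie_add lie_smul
  have : B.compr₂ (V.dilation γ) = B.compl₁₂ (V.dilation γ) (V.dilation γ) := by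
    refine V.linearMap_ext fun i x hx => V.linearMap_ext fun j y hy => ?_
    simp [B, V.dilation_apply_of_mem γ hx, V.dilation_apply_of_mem γ hy,
      V.dilation_apply_of_mem γ (V.lie_mem i j x hx y hy), pow_add, smul_smul, mul_comm]
  simpa [B] using LinearMap.congr_fun₂ this x y

theorem dilation_mul (γ δ : K) : V.dilation (γ * δ) = V.dilation γ ∘ₗ V.dilation δ := by
  refine V.linearMap_ext fun k x hx => ?_
  simp [V.dilation_apply_of_mem _ hx, mul_pow, smul_smul, mul_comm]

theorem dilation_one : V.dilation (1 : K) = LinearMap.id := by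
  refine V.linearMap_ext fun k x hx => ?_
  simp [V.dilation_apply_of_mem _ hx]

/-- The dilation as a morphism of Lie algebras. -/
noncomputable def dilationLieHom (γ : K) : L →ₗ⁅K⁆ L where
  __ := V.dilation γ
  map_lie' := V.dilation_lie γ _ _

theorem repr_dilation {ι : Type*} (X : Module.Basis ι K L) {γ : K} {i : ι} {k : ι → ℕ}
    (hk : ∀ i, X i ∈ V.piece (k i)) (x : L) :
    X.repr (V.dilation γ x) i = γ ^ k i * X.repr x i := by
  have : (X.coord i) ∘ₗ V.dilation γ = γ ^ k i • X.coord i := by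
    refine X.ext fun j => ?_
    rcases eq_or_ne j i with rfl | hij
    · simp [V.dilation_apply_of_mem γ (hk j)]
    · simp [V.dilation_apply_of_mem γ (hk j), Finsupp.single_eq_of_ne hij.symm]
  simpa using LinearMap.congr_fun this x

theorem nonempty_of_homogeneousDim_pos {ι : Type*} (X : Module.Basis ι K L)
    (h : 0 < V.homogeneousDim) : Nonempty ι := by
  by_contra hι
  rw [not_nonempty_iff] at hι
  have : Subsingleton L := X.repr.toEquiv.subsingleton
  refine h.ne' ?_
  unfold homogeneousDim
  simp [Module.finrank_zero_of_subsingleton]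

end Algebra

section Group

variable {K L : Type*} [Field K] [LieRing L] [LieAlgebra K L] (V : LieGradation K L)
  [TopologicalSpace L] {G : Type*} [TopologicalSpace G]

theorem groupDilation_mul (exp : L ≃ₜ G) (γ δ : K) (x : G) :
    V.groupDilation exp (γ * δ) x = V.groupDilation exp γ (V.groupDilation exp δ x) := by
  simp [groupDilation, dilation_mul]

theorem groupDilation_one (exp : L ≃ₜ G) (x : G) : V.groupDilation exp (1 : K) x = x := by
  simp [groupDilation, dilation_one]

variable [TopologicalSpace K] [IsTopologicalRing K] [IsModuleTopology K L]

/-- The dilation of the group by `γ ≠ 0`, as an isomorphism of topological groups. -/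
noncomputable def dilationEquiv [Group G] (exp : L ≃ₜ G) (hexp : IsExponentialMap K exp) {γ : K}
    (hγ : γ ≠ 0) : G ≃ₜ* G where
  toFun := V.groupDilation exp γ
  invFun := V.groupDilation exp γ⁻¹
  left_inv x := by rw [← groupDilation_mul, inv_mul_cancel₀ hγ, groupDilation_one]
  right_inv x := by rw [← groupDilation_mul, mul_inv_cancel₀ hγ, groupDilation_one]
  map_mul' x y := by
    obtain ⟨x, rfl⟩ := exp.surjective x
    obtain ⟨y, rfl⟩ := exp.surjective y
    simp only [groupDilation, hexp.exp_mul_exp, Homeomorph.symm_apply_apply]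
    exact congrArg exp (map_bch (V.dilationLieHom γ) x y)
  continuous_toFun := by
    have : ContinuousAdd L := IsModuleTopology.toContinuousAdd K L
    exact exp.continuous.comp
      ((IsModuleTopology.continuous_of_linearMap (V.dilation γ)).comp exp.symm.continuous)
  continuous_invFun := by
    have : ContinuousAdd L := IsModuleTopology.toContinuousAdd K L
    exact exp.continuous.comp
      ((IsModuleTopology.continuous_of_linearMap (V.dilation γ⁻¹)).comp exp.symm.continuous)

end Group

end LieGradation

/-! ### Topology of the group -/

section Topology

variable (K : Type*) [Field K] [ValuativeRel K] [TopologicalSpace K] [IsNonarchimedeanLocalField K]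

/-- The rank-one valuation makes `K` a proper normed field. Second countability passes to `G`, where
it makes multiplication jointly measurable and Haar measure σ-finite and regular. -/
theorem IsNonarchimedeanLocalField.secondCountableTopology : SecondCountableTopology K := by
  let := IsTopologicalAddGroup.rightUniformSpace K
  have := isUniformAddGroup_of_addCommGroup (G := K)
  let : (Valued.v (R := K)).RankOne :=
  { hom' := ValuativeRel.IsRankLeOne.nonempty.some.emb (R := K).comp
      MonoidWithZeroHom.ValueGroup₀.embedding
    strictMono' := ValuativeRel.IsRankLeOne.nonempty.some.strictMono.comp
        MonoidWithZeroHom.ValueGroup₀.embedding_strictMono }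
  open scoped Valued in
  have : ProperSpace K := .of_nontriviallyNormedField_of_weaklyLocallyCompactSpace K
  infer_instance

variable {K} {L : Type*} [AddCommGroup L] [Module K L] [TopologicalSpace L] [IsModuleTopology K L]

/-- The coordinates of a basis, as a homeomorphism. -/
noncomputable def Module.Basis.coordHomeomorph {ι : Type*} [Fintype ι] (X : Module.Basis ι K L) :
    L ≃ₜ (ι → K) where
  toEquiv := X.equivFun.toEquiv
  continuous_toFun := by
    have : ContinuousAdd L := IsModuleTopology.toContinuousAdd K L
    exact IsModuleTopology.continuous_of_linearMap X.equivFun.toLinearMap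
  continuous_invFun := by
    have : ContinuousAdd L := IsModuleTopology.toContinuousAdd K L
    exact IsModuleTopology.continuous_of_linearMap X.equivFun.symm.toLinearMap

theorem Module.Basis.secondCountableTopology {ι : Type*} [Finite ι] (X : Module.Basis ι K L) :
    SecondCountableTopology L := by
  have := Fintype.ofFinite ι
  have := IsNonarchimedeanLocalField.secondCountableTopology K
  exact X.coordHomeomorph.secondCountableTopology


end Topology

/-! ### The compact open set `G_0` -/

section Lattice

variable {K : Type*} [Field K] [ValuativeRel K] {L : Type*} [LieRing L] [LieAlgebra K L]
  [TopologicalSpace L] {ι : Type*} {G : Type*} [TopologicalSpace G] (exp : L ≃ₜ G)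
  (X : Module.Basis ι K L)

namespace LieGradation

theorem mem_unitLattice {x : G} : x ∈ unitLattice exp X ↔ ∀ i, X.repr (exp.symm x) i ∈ 𝒪[K] := by
  constructor
  · rintro ⟨y, hy, rfl⟩
    simpa using hy
  · exact fun h => ⟨exp.symm x, h, by simp⟩

variable [TopologicalSpace K] [IsNonarchimedeanLocalField K] [IsModuleTopology K L] [Finite ι]

theorem exists_homeomorph_unitLattice : ∃ e : G ≃ₜ (ι → K),
    unitLattice exp X = e ⁻¹' Set.univ.pi fun _ => (𝒪[K] : Set K) := by
  have := Fintype.ofFinite ι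
  refine ⟨exp.symm.trans X.coordHomeomorph, ?_⟩
  ext x
  rw [mem_unitLattice]
  simp [Module.Basis.coordHomeomorph]

theorem isCompact_unitLattice : IsCompact (unitLattice exp X) := by
  obtain ⟨e, he⟩ := exists_homeomorph_unitLattice exp X
  rw [he, e.isCompact_preimage]
  exact isCompact_univ_pi fun _ => IsNonarchimedeanLocalField.isCompact_closedBall K 1

theorem isOpen_unitLattice : IsOpen (unitLattice exp X) := by
  obtain ⟨e, he⟩ := exists_homeomorph_unitLattice exp X
  rw [he, e.isOpen_preimage]
  exact isOpen_set_pi Set.finite_univ fun _ _ => (ValuativeRel.valuation K).isOpen_integer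

theorem isClosed_unitLattice : IsClosed (unitLattice exp X) := by
  obtain ⟨e, he⟩ := exists_homeomorph_unitLattice exp X
  rw [he, e.isClosed_preimage]
  exact isClosed_set_pi fun _ _ => (ValuativeRel.valuation K).isClosed_integer

end LieGradation

end Lattice

/-! ### Convolution with a shell kernel -/

section Convolution

variable {G : Type*} [MeasurableSpace G]

theorem measurable_of_eq_on_shells {S : ℤ → Set G} (hSm : ∀ n, MeasurableSet (S n))
    {k : G → ℝ≥0∞} (w : ℤ → ℝ≥0∞) (hk : ∀ n, ∀ z ∈ S n, k z = w n)
    (hk0 : ∀ z, (∀ n, z ∉ S n) → k z = 0) : Measurable k := by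
  have : k = fun z => ⨆ n, (S n).indicator (fun _ => w n) z := by
    funext z
    refine le_antisymm ?_ (iSup_le fun n => Set.indicator_apply_le fun hz => (hk n z hz).ge)
    by_cases h : ∃ n, z ∈ S n
    · obtain ⟨n, hn⟩ := h
      refine le_trans (le_of_eq ?_) (le_iSup _ n)
      rw [Set.indicator_of_mem hn, hk n z hn]
    · rw [hk0 z (not_exists.1 h)]
      exact zero_le
  rw [this]
  exact Measurable.iSup fun n => measurable_const.indicator (hSm n)

variable [Group G] [MeasurableMul₂ G] [MeasurableInv G]

theorem exists_groupConvolution_bound (μ : Measure G) [SigmaFinite μ]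
    [μ.IsMulLeftInvariant] {S : ℤ → Set G} (hSm : ∀ n, MeasurableSet (S n)) {τ : ℝ} (hτ : 0 < τ)
    {A : ℝ≥0} (hS : ∀ n, μ (S n) ≤ A * ENNReal.ofReal (Real.exp (-(n * τ))))
    (hSinv : ∀ n, μ (Inv.inv ⁻¹' S n) ≤ A * ENNReal.ofReal (Real.exp (-(n * τ))))
    {r s α : ℝ} (hr : 1 < r) (hs : 1 < s) (hα : α < 1) (hsum : 1 / s = 1 / r + α - 1)
    {κ : G → ℝ} (hκm : Measurable κ) (hκ0 : ∀ z, 0 ≤ κ z)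
    (hκ : IsShellKernel S τ α fun z => ENNReal.ofReal (κ z)) :
    ∃ C : ℝ≥0, ∀ f : G → ℂ, MemLp f (ENNReal.ofReal r) μ →
      (∀ᵐ x ∂μ, Integrable (fun y => f y * ((κ (y⁻¹ * x) : ℝ) : ℂ)) μ) ∧
      MemLp (groupConvolution μ f κ) (ENNReal.ofReal s) μ ∧
      eLpNorm (groupConvolution μ f κ) (ENNReal.ofReal s) μ ≤
        C * eLpNorm f (ENNReal.ofReal r) μ := by
  have hr0 : 0 < r := by linarith
  have hs0 : 0 < s := by linarith
  have hL : ∀ {p : ℝ} (_ : 0 < p) (g : G → ℂ), eLpNorm g (ENNReal.ofReal p) μ =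
      (∫⁻ x, ‖g x‖ₑ ^ p ∂μ) ^ (1 / p) := fun {p} hp g => by
    rw [eLpNorm_eq_lintegral_rpow_enorm_toReal (by simpa using hp) ENNReal.ofReal_ne_top,
      ENNReal.toReal_ofReal hp.le]
  obtain ⟨C, hC⟩ := exists_lintegral_shellKernel_rpow_le μ hSm hτ hS hSinv hr hs hα hsum
  refine ⟨C, fun f hf => ?_⟩
  have hdiv : Measurable fun p : G × G => p.2⁻¹ * p.1 := measurable_snd.inv.mul measurable_fst
  -- A strongly measurable representative changes none of the integrals and makes Tonelli available.
  obtain ⟨g, hg, hfg⟩ := hf.aestronglyMeasurable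
  set k : G → ℝ≥0∞ := fun z => ENNReal.ofReal (κ z) with hk
  have hkm : Measurable k := hκm.ennreal_ofReal
  set I : G → ℝ≥0∞ := fun x => ∫⁻ y, (‖g y‖₊ : ℝ≥0∞) * k (y⁻¹ * x) ∂μ with hI
  have hnorm : ∫⁻ x, ‖f x‖ₑ ^ r ∂μ = ∫⁻ x, (‖g x‖₊ : ℝ≥0∞) ^ r ∂μ :=
    lintegral_congr_ae (hfg.mono fun x hx => by simp only [hx]; rfl)
  have hfin : ∫⁻ x, (‖g x‖₊ : ℝ≥0∞) ^ r ∂μ ≠ ∞ := by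
    rw [← hnorm]
    have := hf.eLpNorm_ne_top
    rw [hL hr0] at this
    intro h
    rw [h, ENNReal.top_rpow_of_pos (one_div_pos.2 hr0)] at this
    exact this rfl
  have hIs := hC k hkm hκ (fun y => ‖g y‖₊) hg.measurable.nnnorm hfin
  rw [← hnorm, ← hL hr0] at hIs
  have hIm : Measurable I := by
    refine Measurable.lintegral_prod_right' (f := fun p : G × G =>
      (‖g p.2‖₊ : ℝ≥0∞) * k (p.2⁻¹ * p.1)) ?_
    exact (hg.measurable.nnnorm.coe_nnreal_ennreal.comp measurable_snd).mul (hkm.comp hdiv)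
  have hbound : C * eLpNorm f (ENNReal.ofReal r) μ < ∞ :=
    ENNReal.mul_lt_top ENNReal.coe_lt_top hf.eLpNorm_lt_top
  have henorm : ∀ x y, ‖g y * ((κ (y⁻¹ * x) : ℝ) : ℂ)‖ₑ = (‖g y‖₊ : ℝ≥0∞) * k (y⁻¹ * x) := by
    intro x y
    rw [enorm_mul, ← ofReal_norm (((κ (y⁻¹ * x) : ℝ) : ℂ)), Complex.norm_real,
      Real.norm_of_nonneg (hκ0 _)]
    rfl
  have hprod : StronglyMeasurable fun p : G × G => g p.2 * ((κ (p.2⁻¹ * p.1) : ℝ) : ℂ) :=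
    (hg.comp_measurable measurable_snd).mul
      (Complex.measurable_ofReal.comp (hκm.comp hdiv)).stronglyMeasurable
  have hae : ∀ x, (fun y => f y * ((κ (y⁻¹ * x) : ℝ) : ℂ)) =ᵐ[μ]
      fun y => g y * ((κ (y⁻¹ * x) : ℝ) : ℂ) := fun x => hfg.mono fun y hy => by simp only [hy]
  have hconv : groupConvolution μ f κ = fun x => ∫ y, g y * ((κ (y⁻¹ * x) : ℝ) : ℂ) ∂μ :=
    funext fun x => integral_congr_ae (hae x)
  have hle : eLpNorm (groupConvolution μ f κ) (ENNReal.ofReal s) μ ≤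
      C * eLpNorm f (ENNReal.ofReal r) μ := by
    rw [hL hs0, one_div, ENNReal.rpow_inv_le_iff hs0]
    refine le_trans (lintegral_mono fun x => ?_) hIs
    refine ENNReal.rpow_le_rpow ?_ hs0.le
    rw [hconv]
    refine (enorm_integral_le_lintegral_enorm _).trans (le_of_eq ?_)
    exact lintegral_congr fun y => henorm x y
  refine ⟨?_, ⟨?_, hle.trans_lt hbound⟩, hle⟩
  -- Absolute convergence almost everywhere follows from the `L^s` bound for `|f| * k`: a function
  -- with finite integral is finite almost everywhere.
  · have hfin : ∀ᵐ x ∂μ, I x ^ s < ∞ :=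
      ae_lt_top (hIm.pow_const s) (hIs.trans_lt (ENNReal.rpow_lt_top_of_nonneg hs0.le hbound.ne)).ne
    filter_upwards [hfin] with x hx
    refine Integrable.congr ⟨(hprod.comp_measurable measurable_prodMk_left).aestronglyMeasurable, ?_⟩
      (hae x).symm
    rw [hasFiniteIntegral_iff_enorm]
    refine lt_of_eq_of_lt (lintegral_congr fun y => henorm x y) ?_
    rwa [ENNReal.rpow_lt_top_iff_of_pos hs0] at hx
  · rw [hconv]
    exact hprod.integral_prod_right'.aestronglyMeasurable

end Convolution

/-! ### The measure of the sets of the filtration -/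

/-- Uniqueness of Haar measure: the push-forward under an automorphism is again a Haar measure. -/
theorem MeasureTheory.Measure.exists_measure_image_eq_mul {G : Type*} [Group G]
    [TopologicalSpace G] [IsTopologicalGroup G] [LocallyCompactSpace G] [MeasurableSpace G]
    [BorelSpace G] (μ : Measure G) [μ.IsHaarMeasure] [μ.Regular] (φ : G ≃ₜ* G) :
    ∃ c : ℝ≥0, ∀ E : Set G, μ (φ '' E) = c * μ E := by
  refine ⟨mulEquivHaarChar φ, fun E => ?_⟩
  have h := congrArg (fun ν : Measure G => ν (φ '' E)) (mulEquivHaarChar_smul_map μ φ)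
  simp only [Measure.smul_apply] at h
  rw [← h, show μ.map φ = μ.map φ.toHomeomorph.toMeasurableEquiv from rfl,
    MeasurableEquiv.map_apply, ENNReal.smul_def, smul_eq_mul]
  congr 2
  exact Set.preimage_image_eq E φ.injective

theorem eq_ofReal_exp_mul_of_forall_succ {a : ℤ → ℝ≥0∞} {τ : ℝ}
    (h : ∀ n, a (n + 1) = ENNReal.ofReal (Real.exp (-τ)) * a n) (n : ℤ) :
    a n = ENNReal.ofReal (Real.exp (-(n * τ))) * a 0 := by
  induction n with
  | zero => simp
  | succ n ih =>
    rw [h, ih, ← mul_assoc, ← ENNReal.ofReal_mul (Real.exp_pos _).le, ← Real.exp_add]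
    congr 3
    push_cast
    ring
  | pred n ih =>
    have h1 := h (-n - 1)
    rw [sub_add_cancel, ih] at h1
    have h2 : a (-n - 1) = ENNReal.ofReal (Real.exp τ) *
        (ENNReal.ofReal (Real.exp (-τ)) * a (-n - 1)) := by
      rw [← mul_assoc, ← ENNReal.ofReal_mul (Real.exp_pos _).le, ← Real.exp_add]
      simp
    rw [h2, ← h1, ← mul_assoc, ← ENNReal.ofReal_mul (Real.exp_pos _).le, ← Real.exp_add]
    congr 3
    push_cast
    ring

namespace LieGradation

section Filtration

variable {K : Type*} [Field K] [ValuativeRel K] {L : Type*} [LieRing L] [LieAlgebra K L]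
  [TopologicalSpace L] {G : Type*} [TopologicalSpace G] {ι : Type*}
  (V : LieGradation K L) (exp : L ≃ₜ G) (X : Module.Basis ι K L) {ϖ : 𝒪[K]}

theorem filtration_zero : V.filtration exp X ϖ 0 = unitLattice exp X := by
  simp [filtration, groupDilation_one]

theorem filtration_succ (hϖ : (ϖ : K) ≠ 0) (n : ℤ) :
    V.filtration exp X ϖ (n + 1) = V.groupDilation exp (ϖ : K) '' V.filtration exp X ϖ n := by
  simp only [filtration, Set.image_image, ← groupDilation_mul, zpow_add_one₀ hϖ, mul_comm]

theorem filtration_antitone (hX : ∀ i, ∃ k, X i ∈ V.piece k) (hϖ : (ϖ : K) ≠ 0) :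
    Antitone (V.filtration exp X ϖ) := by
  choose k hk using hX
  refine antitone_int_of_succ_le fun n => ?_
  rw [filtration, zpow_add_one₀ hϖ]
  rintro _ ⟨x, hx, rfl⟩
  refine ⟨V.groupDilation exp (ϖ : K) x, ?_, (V.groupDilation_mul exp _ _ x).symm⟩
  rw [mem_unitLattice] at hx ⊢
  intro i
  rw [groupDilation, Homeomorph.symm_apply_apply, V.repr_dilation X hk]
  exact mul_mem (pow_mem ϖ.2 _) (hx i)

/-- The witness is `exp (X i)`: membership in `G_1` would give `1 = ϖ ^ k * c` with `c ∈ 𝒪` and `k ≥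
1`, making `ϖ` a unit. Here `k ≠ 0` because `V_0 = 0`. -/
theorem exists_mem_unitLattice_notMem_filtration_one [Nonempty ι]
    (hX : ∀ i, ∃ k, X i ∈ V.piece k) (hϖ : Irreducible ϖ) :
    ∃ x ∈ unitLattice exp X, x ∉ V.filtration exp X ϖ 1 := by
  choose k hk using hX
  obtain ⟨i⟩ := ‹Nonempty ι›
  refine ⟨exp (X i), ?_, ?_⟩
  · classical
    rw [mem_unitLattice]
    intro j
    rw [Homeomorph.symm_apply_apply, X.repr_self, Finsupp.single_apply]
    split_ifs
    exacts [one_mem _, zero_mem _]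
  · rintro ⟨x, hx, hxi⟩
    rw [mem_unitLattice] at hx
    have h1 := V.repr_dilation X (γ := (ϖ : K)) (i := i) hk (exp.symm x)
    rw [zpow_one, groupDilation, exp.injective.eq_iff] at hxi
    rw [hxi, X.repr_self, Finsupp.single_eq_same] at h1
    have hk0 : k i ≠ 0 := by
      intro h0
      have := hk i
      rw [h0, V.piece_zero, Submodule.mem_bot] at this
      exact X.ne_zero i this
    have h2 : (1 : 𝒪[K]) = ϖ ^ k i * ⟨X.repr (exp.symm x) i, hx i⟩ := Subtype.ext h1
    have h3 : IsUnit (ϖ ^ k i) := IsUnit.of_mul_eq_one _ h2.symm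
    exact hϖ.not_isUnit ((isUnit_pow_iff hk0).1 h3)

/-- The shell `G_n \ G_{n+1}`. -/
def shell (ϖ : 𝒪[K]) (n : ℤ) : Set G :=
  V.filtration exp X ϖ n \ V.filtration exp X ϖ (n + 1)

/-- Disjointness of the shells makes the index chosen in `filtrationNorm` the expected one. -/
theorem eq_of_mem_shell (hX : ∀ i, ∃ k, X i ∈ V.piece k) (hϖ : (ϖ : K) ≠ 0) {m n : ℤ} {x : G}
    (hm : x ∈ V.shell exp X ϖ m) (hn : x ∈ V.shell exp X ϖ n) : m = n := by
  by_contra h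
  rcases lt_or_gt_of_ne h with h | h
  · exact hm.2 (filtration_antitone V exp X hX hϖ (Int.add_one_le_of_lt h) hn.1)
  · exact hn.2 (filtration_antitone V exp X hX hϖ (Int.add_one_le_of_lt h) hm.1)

variable [MeasurableSpace G] (μ : Measure G)

theorem filtrationNorm_of_mem_shell (hX : ∀ i, ∃ k, X i ∈ V.piece k) (hϖ : (ϖ : K) ≠ 0)
    {n : ℤ} {x : G} (hx : x ∈ V.shell exp X ϖ n) :
    filtrationNorm μ (V.filtration exp X ϖ) x = μ.real (V.filtration exp X ϖ n) := by
  have h : ∃ n : ℤ, x ∈ V.filtration exp X ϖ n ∧ x ∉ V.filtration exp X ϖ (n + 1) := ⟨n, hx⟩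
  rw [filtrationNorm, dif_pos h, eq_of_mem_shell V exp X hX hϖ h.choose_spec hx]

theorem filtrationNorm_of_notMem_shell {x : G} (hx : ∀ n, x ∉ V.shell exp X ϖ n) :
    filtrationNorm μ (V.filtration exp X ϖ) x = 0 := by
  rw [filtrationNorm, dif_neg fun ⟨n, hn⟩ => hx n hn]

end Filtration

section Topology

variable {K : Type*} [Field K] [ValuativeRel K] [TopologicalSpace K] [IsNonarchimedeanLocalField K]
  {L : Type*} [LieRing L] [LieAlgebra K L] [TopologicalSpace L] [IsModuleTopology K L]
  {G : Type*} [TopologicalSpace G] {ι : Type*} [Finite ι]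

theorem secondCountableTopology_of_basis (exp : L ≃ₜ G) (X : Module.Basis ι K L) :
    SecondCountableTopology G := by
  have := X.secondCountableTopology
  exact exp.symm.secondCountableTopology

theorem locallyCompactSpace_of_basis (exp : L ≃ₜ G) (X : Module.Basis ι K L) :
    LocallyCompactSpace G := by
  have := Fintype.ofFinite ι
  have : LocallyCompactSpace L := X.coordHomeomorph.isClosedEmbedding.locallyCompactSpace
  exact exp.symm.isClosedEmbedding.locallyCompactSpace

end Topology

section Measure

variable {K : Type*} [Field K] [ValuativeRel K] [TopologicalSpace K] [IsNonarchimedeanLocalField K]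
  {L : Type*} [LieRing L] [LieAlgebra K L] [TopologicalSpace L] [IsModuleTopology K L]
  {G : Type*} [Group G] [TopologicalSpace G] {ι : Type*}
  (V : LieGradation K L) {exp : L ≃ₜ G} (X : Module.Basis ι K L)
  {ϖ : 𝒪[K]}

theorem filtration_eq_image (hexp : IsExponentialMap K exp) (hϖ : (ϖ : K) ≠ 0) (n : ℤ) :
    V.filtration exp X ϖ n =
    (V.dilationEquiv exp hexp (zpow_ne_zero n hϖ)) '' unitLattice exp X := rfl

theorem shell_succ (hϖ : (ϖ : K) ≠ 0) (hexp : IsExponentialMap K exp) (n : ℤ) :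
    V.shell exp X ϖ (n + 1) = V.groupDilation exp (ϖ : K) '' V.shell exp X ϖ n := by
  unfold shell
  rw [filtration_succ V exp X hϖ (n + 1), filtration_succ V exp X hϖ n]
  exact (Set.image_sdiff (V.dilationEquiv exp hexp hϖ).injective _ _).symm

/-- A dilation is a group automorphism, so it commutes with inversion; inverted shells therefore
scale by the same factor as the shells. -/
theorem inv_shell_succ (hϖ : (ϖ : K) ≠ 0) (hexp : IsExponentialMap K exp) (n : ℤ) :
    Inv.inv ⁻¹' V.shell exp X ϖ (n + 1) =
      V.groupDilation exp (ϖ : K) '' (Inv.inv ⁻¹' V.shell exp X ϖ n) := by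
  rw [shell_succ V X hϖ hexp]
  ext x
  set φ := V.dilationEquiv exp hexp hϖ
  constructor
  · rintro ⟨y, hy, hyx⟩
    refine ⟨y⁻¹, by simpa using hy, ?_⟩
    change φ y = x⁻¹ at hyx
    change φ y⁻¹ = x
    rw [map_inv, hyx, inv_inv]
  · rintro ⟨y, hy, rfl⟩
    exact ⟨y⁻¹, hy, map_inv φ y⟩

variable [Finite ι]

theorem isOpen_filtration (hexp : IsExponentialMap K exp) (hϖ : (ϖ : K) ≠ 0) (n : ℤ) :
    IsOpen (V.filtration exp X ϖ n) := by
  rw [filtration_eq_image V X hexp hϖ]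
  exact (V.dilationEquiv exp hexp (zpow_ne_zero n hϖ)).toHomeomorph.isOpenMap _
    (isOpen_unitLattice exp X)

theorem isClosed_filtration (hexp : IsExponentialMap K exp) (hϖ : (ϖ : K) ≠ 0) (n : ℤ) :
    IsClosed (V.filtration exp X ϖ n) := by
  rw [filtration_eq_image V X hexp hϖ]
  exact (V.dilationEquiv exp hexp (zpow_ne_zero n hϖ)).toHomeomorph.isClosedMap _
    (isClosed_unitLattice exp X)

variable [IsTopologicalGroup G] [MeasurableSpace G] [BorelSpace G] [LocallyCompactSpace G]
  [SecondCountableTopology G] (μ : Measure G) [μ.IsHaarMeasure]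

/-- Dilation by a uniformizer scales every set by the same factor `e^{-τ} < 1`. -/
theorem exists_measure_image_dilation [Nonempty ι] (hexp : IsExponentialMap K exp)
    (hX : ∀ i, ∃ k, X i ∈ V.piece k) (hϖ : Irreducible ϖ) (hμ : μ (unitLattice exp X) = 1) :
    ∃ τ : ℝ, 0 < τ ∧ ∀ E : Set G,
      μ (V.groupDilation exp (ϖ : K) '' E) = ENNReal.ofReal (Real.exp (-τ)) * μ E := by
  have hϖ0 : (ϖ : K) ≠ 0 := fun h => hϖ.ne_zero (Subtype.ext h)
  obtain ⟨c, hc⟩ := Measure.exists_measure_image_eq_mul μ (V.dilationEquiv exp hexp hϖ0)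
  have hG1 : μ (V.filtration exp X ϖ 1) = c := by
    have := hc (unitLattice exp X)
    rw [hμ, mul_one] at this
    rw [← this, ← zero_add (1 : ℤ), filtration_succ V exp X hϖ0, filtration_zero]
    rfl
  have hsub : V.filtration exp X ϖ 1 ⊆ unitLattice exp X := by
    rw [← V.filtration_zero exp X (ϖ := ϖ)]
    exact filtration_antitone V exp X hX hϖ0 zero_le_one
  have hopen1 := isOpen_filtration V X hexp hϖ0 1
  have hne : (V.filtration exp X ϖ 1).Nonempty := by
    refine Set.Nonempty.image _ ?_
    by_contra h
    rw [Set.not_nonempty_iff_eq_empty] at h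
    simp [h] at hμ
  have hc0 : 0 < c := by
    have := hopen1.measure_pos μ hne
    rw [hG1] at this
    exact_mod_cast this
  -- `G_0 \ G_1` is open and nonempty, so it has positive measure; hence `c = |G_1| < |G_0| = 1`.
  have hc1 : c < 1 := by
    obtain ⟨x, hx, hx1⟩ := V.exists_mem_unitLattice_notMem_filtration_one exp X hX hϖ
    have hpos : 0 < μ (unitLattice exp X \ V.filtration exp X ϖ 1) :=
      ((isOpen_unitLattice exp X).sdiff (isClosed_filtration V X hexp hϖ0 1)).measure_pos μ
        ⟨x, hx, hx1⟩
    have hadd := measure_sdiff_add_inter (μ := μ) (unitLattice exp X) hopen1.measurableSet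
    rw [Set.inter_eq_self_of_subset_right hsub, hG1, hμ] at hadd
    by_contra hge
    have h1 : (1 : ℝ≥0∞) ≤ c := by exact_mod_cast not_lt.1 hge
    have : (1 : ℝ≥0∞) < 1 := by
      calc (1 : ℝ≥0∞) = 0 + 1 := (zero_add _).symm
        _ < μ (unitLattice exp X \ V.filtration exp X ϖ 1) + 1 :=
            ENNReal.add_lt_add_right ENNReal.one_ne_top hpos
        _ ≤ _ := (add_le_add_right h1 _).trans hadd.le
    exact lt_irrefl _ this
  refine ⟨-Real.log c, neg_pos.2 (Real.log_neg (by exact_mod_cast hc0) (by exact_mod_cast hc1)),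
    fun E => ?_⟩
  rw [neg_neg, Real.exp_log (by exact_mod_cast hc0), ENNReal.ofReal_coe_nnreal]
  exact hc E

end Measure
end LieGradation

/-! ### The inequality on the graded group -/

theorem mainTheorem11
    {K : Type*} [Field K] [ValuativeRel K] [TopologicalSpace K] [IsNonarchimedeanLocalField K]
    {L : Type*} [LieRing L] [LieAlgebra K L] [FiniteDimensional K L] [LieRing.IsNilpotent L]
    [TopologicalSpace L] [IsModuleTopology K L]
    {G : Type*} [Group G] [TopologicalSpace G] [IsTopologicalGroup G]
    [MeasurableSpace G] [BorelSpace G]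
    -- the graded group `G`, with exponential map `exp` and graded Lie algebra `L = ⨁ V_k`
    (exp : L ≃ₜ G) (hexp : IsExponentialMap K exp) (V : LieGradation K L)
    -- a basis of eigenvectors of the dilations and a uniformizer, which determine the sequence `G_n`
    {ι : Type*} (X : Module.Basis ι K L) (hX : ∀ i, ∃ k, X i ∈ V.piece k)
    (ϖ : 𝒪[K]) (hϖ : Irreducible ϖ)
    -- the Haar measure normalized by `|G_0| = 1`
    (μ : Measure G) [μ.IsHaarMeasure] (hμ : μ (LieGradation.unitLattice exp X) = 1)
    (r s lam : ℝ) (hr : 1 < r) (hrs : r < s)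
    (hlam : 0 < lam) (hlamQ : lam < (V.homogeneousDim : ℝ))
    (hexponents : 1 / s = 1 / r + lam / (V.homogeneousDim : ℝ) - 1) :
    ∃ C : ℝ≥0, ∀ f : G → ℂ, MemLp f (ENNReal.ofReal r) μ →
      (∀ᵐ x ∂μ, Integrable
        (fun y => f y * ((V.quasiNorm exp X ϖ μ (y⁻¹ * x) ^ (-lam) : ℝ) : ℂ)) μ) ∧
      MemLp (groupConvolution μ f fun z => V.quasiNorm exp X ϖ μ z ^ (-lam))
        (ENNReal.ofReal s) μ ∧
      eLpNorm (groupConvolution μ f fun z => V.quasiNorm exp X ϖ μ z ^ (-lam))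
        (ENNReal.ofReal s) μ ≤ C * eLpNorm f (ENNReal.ofReal r) μ := by
  have hQ : (0 : ℝ) < V.homogeneousDim := hlam.trans hlamQ
  have : Finite ι := Module.Finite.finite_basis X
  have : Nonempty ι := V.nonempty_of_homogeneousDim_pos X (by exact_mod_cast hQ)
  have : LocallyCompactSpace G := LieGradation.locallyCompactSpace_of_basis exp X
  have : SecondCountableTopology G := LieGradation.secondCountableTopology_of_basis exp X
  have hϖ0 : (ϖ : K) ≠ 0 := fun h => hϖ.ne_zero (Subtype.ext h)
  obtain ⟨τ, hτ, hdil⟩ := V.exists_measure_image_dilation X μ hexp hX hϖ hμ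
  have hG : ∀ n : ℤ, μ (V.filtration exp X ϖ n) = ENNReal.ofReal (Real.exp (-(n * τ))) := by
    intro n
    have := eq_ofReal_exp_mul_of_forall_succ (a := fun n => μ (V.filtration exp X ϖ n)) (τ := τ)
      (fun n => by rw [V.filtration_succ exp X hϖ0, hdil]) n
    rwa [V.filtration_zero exp X, hμ, mul_one] at this
  have hSm : ∀ n, MeasurableSet (V.shell exp X ϖ n) := fun n =>
    (V.isOpen_filtration X hexp hϖ0 n).measurableSet.diff
      (V.isOpen_filtration X hexp hϖ0 (n + 1)).measurableSet
  have hinv := eq_ofReal_exp_mul_of_forall_succ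
    (a := fun n => μ (Inv.inv ⁻¹' V.shell exp X ϖ n)) (τ := τ)
    (fun n => by rw [V.inv_shell_succ X hϖ0 hexp, hdil])
  have hfin : μ (Inv.inv ⁻¹' V.shell exp X ϖ 0) ≠ ∞ := by
    refine ne_top_of_le_ne_top ?_ (measure_mono (Set.preimage_mono Set.sdiff_subset))
    rw [V.filtration_zero exp X]
    exact ((Homeomorph.inv G).isCompact_preimage.2
      (LieGradation.isCompact_unitLattice exp X)).measure_lt_top.ne
  -- The 1 serves the shells, since `|G_0| = 1`; the other entry is the measure of the inverted
  -- shell at `n = 0`, finite by compactness of `G_0`.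
  set A : ℝ≥0 := max 1 (μ (Inv.inv ⁻¹' V.shell exp X ϖ 0)).toNNReal with hA
  have hS : ∀ n : ℤ, μ (V.shell exp X ϖ n) ≤ A * ENNReal.ofReal (Real.exp (-(n * τ))) := by
    intro n
    refine (measure_mono Set.sdiff_subset).trans ((hG n).le.trans ?_)
    refine le_mul_of_one_le_left' ?_
    exact_mod_cast le_max_left _ _
  have hSinv : ∀ n : ℤ, μ (Inv.inv ⁻¹' V.shell exp X ϖ n) ≤
      A * ENNReal.ofReal (Real.exp (-(n * τ))) := by
    intro n
    rw [hinv n, mul_comm]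
    gcongr
    rw [← ENNReal.coe_toNNReal hfin]
    exact_mod_cast le_max_right _ _
  obtain ⟨κ, hκ⟩ : ∃ κ : G → ℝ, ∀ z, κ z = V.quasiNorm exp X ϖ μ z ^ (-lam) :=
    ⟨_, fun _ => rfl⟩
  simp only [← hκ]
  have hκS : ∀ n : ℤ, ∀ z ∈ V.shell exp X ϖ n,
      κ z = Real.exp (lam / V.homogeneousDim * (n * τ)) := by
    intro n z hz
    rw [hκ, LieGradation.quasiNorm, V.filtrationNorm_of_mem_shell exp X μ hX hϖ0 hz,
      Measure.real, hG,
      ENNReal.toReal_ofReal (Real.exp_pos _).le, ← Real.exp_mul, ← Real.exp_mul]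
    congr 1
    ring
  -- Off all shells the quasi-norm is `0`, and the real power `0 ^ (-lam)` is `0` by convention, so
  -- the kernel vanishes there instead of being infinite.
  have hκN : ∀ z, (∀ n, z ∉ V.shell exp X ϖ n) → κ z = 0 := by
    intro z hz
    rw [hκ, LieGradation.quasiNorm, V.filtrationNorm_of_notMem_shell exp X μ hz,
      Real.zero_rpow (one_div_pos.2 hQ).ne',
      Real.zero_rpow (neg_ne_zero.2 hlam.ne')]
  have hκ0 : ∀ z, 0 ≤ κ z := by
    intro z
    by_cases h : ∃ n, z ∈ V.shell exp X ϖ n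
    · obtain ⟨n, hn⟩ := h
      rw [hκS n z hn]
      positivity
    · rw [hκN z (not_exists.1 h)]
  have hκm : Measurable κ := by
    have : Measurable fun z => ENNReal.ofReal (κ z) :=
      measurable_of_eq_on_shells hSm (fun n : ℤ => ENNReal.ofReal (Real.exp
          (lam / V.homogeneousDim * (n * τ))))
        (fun n z hz => congrArg ENNReal.ofReal (hκS n z hz))
        (fun z hz => by rw [hκN z hz, ENNReal.ofReal_zero])
    have := this.ennreal_toReal
    simpa only [ENNReal.toReal_ofReal (hκ0 _)] using this
  have hκs : IsShellKernel (V.shell exp X ϖ) τ (lam / V.homogeneousDim)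
      fun z => ENNReal.ofReal (κ z) := by
    intro z
    by_cases h : ∃ n, z ∈ V.shell exp X ϖ n
    · obtain ⟨n, hn⟩ := h
      exact Or.inr ⟨n, hn, congrArg ENNReal.ofReal (hκS n z hn)⟩
    · exact Or.inl (by simp only [hκN z (not_exists.1 h), ENNReal.ofReal_zero])
  exact exists_groupConvolution_bound μ hSm hτ hS hSinv hr (hr.trans hrs)
    ((div_lt_one hQ).2 hlamQ) hexponents hκm hκ0 hκs
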